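/- There is a universal constant $C>0$ with the following property. Let $n\ge 2$, $m\ge 1$ and $d_1,\dots,d_m\ge 1$ be integers, let $d:=\max_i d_i$, and let $P=(p_1,\dots,p_m)$ be the random system of homogeneous polynomials $$p_j(x)=\sum_{|a|=d_j} c_{j,a}\sqrt{\binom{d_j}{a}}\,x^a,\qquad x\in\mathbb{R}^n,\quad \binom{d_j}{a}:=\frac{d_j!}{a_1!\cdots a_n!},$$ where the coefficient vectors $C_j=(c_{j,a})_{|a|=d_j}\in\mathbb{R}^{N_j}$, $N_j=\binom{n+d_j-1}{d_j}$, are independent random vectors satisfying the Small Ball assumption with constant $c_0>0$: for all $j$, all nonzero $v\in\mathbb{R}^{N_j}$ and all $\varepsilon>0$, $$\mathrm{Prob}\left(|\langle v,C_j\rangle|\le\varepsilon\|v\|_2\right)\le c_0\,\varepsilon .$$ Let $\alpha,\gamma>0$ satisfy $\alpha\le\gamma\min\{d^{-6},\,d^2/n\}$. Then $$\mathrm{Prob}\left(L(P)\le\alpha\right)\le\mathrm{Prob}\left(\|P\|_\infty\ge\gamma\right)+\alpha^{\frac32+m-n}\,\sqrt{n}\,\left(\gamma d^2\right)^{n-\frac32}\left(\frac{C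 c_0}{\sqrt{m}}\right)^{m}.$$ Here $\|P\|_\infty:=\sup_{x\in S^{n-1}}\|P(x)\|_2$ and $$L(P):=\min_{\substack{x,y\in S^{n-1}\\ x\perp y}}\sqrt{\|\Delta^{-1}DP(x)y\|_2^2+\|P(x)\|_2^2},$$ where $DP(x)$ is the $m\times n$ Jacobian matrix of $P$ at $x$ and $\Delta$ is the $m\times m$ diagonal matrix with diagonal entries $\sqrt{d_1},\dots,\sqrt{d_m}$. -/

import Mathlib

noncomputable section

/-- Exponent vectors `a = (a₁, …, aₙ)` of natural numbers with `a₁ + ⋯ + aₙ = d`; there are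
`(n + d - 1).choose d` of them. -/
abbrev ExponentIndex (n d : ℕ) : Type :=
  ↥(Finset.piAntidiag (Finset.univ : Finset (Fin n)) d)

/-- The form `∑_{|a| = d} c_a √(d! / (a₁! ⋯ aₙ!)) x^a` with coefficient vector `c`. -/
def weylForm {n d : ℕ} (c : EuclideanSpace ℝ (ExponentIndex n d)) : MvPolynomial (Fin n) ℝ :=
  ∑ a : ExponentIndex n d,
    MvPolynomial.monomial (Finsupp.equivFunOnFinite.symm a.1)
      (c a * √(Nat.multinomial Finset.univ a.1 : ℝ))

/-- The value `P(x) ∈ ℝᵐ` of a polynomial system at a point `x ∈ ℝⁿ`. -/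
def evalSystem {n m : ℕ} (P : Fin m → MvPolynomial (Fin n) ℝ)
    (x : EuclideanSpace ℝ (Fin n)) : EuclideanSpace ℝ (Fin m) :=
  WithLp.toLp 2 fun i => MvPolynomial.eval (fun k => x k) (P i)

/-- The vector `DP(x) y ∈ ℝᵐ`: the Jacobian matrix of the system at `x`, applied to `y`. -/
def jacobianApply {n m : ℕ} (P : Fin m → MvPolynomial (Fin n) ℝ)
    (x y : EuclideanSpace ℝ (Fin n)) : EuclideanSpace ℝ (Fin m) :=
  WithLp.toLp 2 fun i =>
    ∑ k : Fin n, MvPolynomial.eval (fun l => x l) (MvPolynomial.pderiv k (P i)) * y k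

/-- The vector `Δ⁻¹ v`, where `Δ` is the diagonal matrix with entries `√d₁, …, √dₘ`. -/
def degreeScale {m : ℕ} (d : Fin m → ℕ) (v : EuclideanSpace ℝ (Fin m)) :
    EuclideanSpace ℝ (Fin m) :=
  WithLp.toLp 2 fun i => (√(d i : ℝ))⁻¹ * v i

/-- `√(‖Δ⁻¹ DP(x) y‖² + ‖P(x)‖²)`. -/
def scriptL {n m : ℕ} (d : Fin m → ℕ) (P : Fin m → MvPolynomial (Fin n) ℝ)
    (x y : EuclideanSpace ℝ (Fin n)) : ℝ :=
  √(‖degreeScale d (jacobianApply P x y)‖ ^ 2 + ‖evalSystem P x‖ ^ 2)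

/-- The pairs of mutually orthogonal points of the unit sphere of `ℝⁿ`. -/
def OrthoPair (n : ℕ) : Type :=
  {q : EuclideanSpace ℝ (Fin n) × EuclideanSpace ℝ (Fin n) //
    ‖q.1‖ = 1 ∧ ‖q.2‖ = 1 ∧ inner ℝ q.1 q.2 = 0}

/-- `L(P)`, the minimum of `scriptL d P x y` over orthogonal unit vectors `x`, `y`. For `2 ≤ n` the
set of these pairs is compact and non-empty, so that the infimum is a minimum. -/
def systemL {n m : ℕ} (d : Fin m → ℕ) (P : Fin m → MvPolynomial (Fin n) ℝ) : ℝ :=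
  ⨅ q : OrthoPair n, scriptL d P q.1.1 q.1.2

/-- `‖P‖_∞`, the supremum over the unit sphere of the Euclidean norm of `P(x)`. -/
def systemSupNorm {n m : ℕ} (P : Fin m → MvPolynomial (Fin n) ℝ) : ℝ :=
  ⨆ x : Metric.sphere (0 : EuclideanSpace ℝ (Fin n)) 1, ‖evalSystem P x.1‖

/-- The Small Ball assumption with constant `c₀` for a random vector `X`. The vector `a` has to be
nonzero: for `a = 0` the event has probability one. -/
def SmallBall {Ω ι : Type*} [MeasurableSpace Ω] [Fintype ι] (μ : MeasureTheory.Measure Ω)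
    (X : Ω → EuclideanSpace ℝ ι) (c₀ : ℝ) : Prop :=
  ∀ a : EuclideanSpace ℝ ι, a ≠ 0 → ∀ ε : ℝ, 0 < ε →
    μ.real {ω | |inner ℝ a (X ω)| ≤ ε * ‖a‖} ≤ c₀ * ε

end

/-! Small `systemL` forces `P` to be small on a set of definite volume, which is unlikely. Suppose
`systemL d P ≤ α` and `‖P‖_∞ < γ`. At a nearly minimizing pair `x`, `y` both `P(x)` and `Δ⁻¹DP(x)y`
are `O(α)`. A Bernstein inequality on great circles bounds first derivatives of `P` by `O(Dγ)` and
second derivatives by `O(D²γ)`. Hence, with `β ~ √(α / (γD²))`, the radial extension of `P` stays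
`O(α)` on a patch around `x` of length `β` along `y` and `β²` in the other `n - 2` directions, of
volume about `β ^ (2n - 3)` (`exists_patch`, `le_volume_sublevel`). At a fixed point of the sphere,
evaluation of a form is a functional of norm one in the coefficients, so tensorized small ball
estimates give `‖P(x)‖ ≤ t` probability at most `(8c₀t/√m)^m`
(`measure_norm_evalSystem_weylForm_le`). Tonelli and Markov turn this into a bound for the
probability of a large sublevel set (`measure_le_volume_sublevel_le`). Dividing by `β ^ (2n - 3)`
yields the factor `(γD²/α) ^ (n - 3/2)`. -/

noncomputable section

/-! ### Bernstein-type inequalities for entire functions of exponential type. -/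

open Complex in
/-- An entire function of exponential type `σ` that is bounded on the real line: bound on the
upper half plane. -/
theorem norm_le_of_exponential_type_of_im_nonneg {E : Type*} [NormedAddCommGroup E]
    [NormedSpace ℂ E] {f : ℂ → E} (hf : Differentiable ℂ f) {K σ M : ℝ}
    (hK : ∀ z : ℂ, ‖f z‖ ≤ K * Real.exp (σ * |z.im|)) (hM : ∀ x : ℝ, ‖f x‖ ≤ M) {z : ℂ}
    (hz : 0 ≤ z.im) : ‖f z‖ ≤ M * Real.exp (σ * z.im) := by
  -- Rotation takes the right half plane to the upper one, and the exponential cancels the growth of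
  -- `f`. So `g` is bounded by `K` there and by `M` on the imaginary axis; Phragmén–Lindelöf
  -- discards `K`.
  set g : ℂ → E := fun w => exp (-σ * w) • f (I * w) with hg
  have hgd : Differentiable ℂ g := by
    intro w
    have h1 : DifferentiableAt ℂ (fun w : ℂ => exp (-σ * w)) w := by fun_prop
    have h2 : DifferentiableAt ℂ (fun w : ℂ => f (I * w)) w :=
      (hf (I * w)).comp w (by fun_prop)
    exact h1.smul h2
  have hnorm : ∀ w : ℂ, ‖g w‖ = Real.exp (-(σ * w.re)) * ‖f (I * w)‖ := by
    intro w
    simp [hg, norm_smul, Complex.norm_exp]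
  have hgb : ∀ w : ℂ, 0 ≤ w.re → ‖g w‖ ≤ K := by
    intro w hw
    rw [hnorm]
    have h1 := hK (I * w)
    have h2 : (I * w).im = w.re := by simp
    rw [h2, abs_of_nonneg hw] at h1
    calc _ ≤ Real.exp (-(σ * w.re)) * (K * Real.exp (σ * w.re)) := by gcongr
      _ = K := by rw [mul_left_comm, ← Real.exp_add]; simp
  have key : ‖g (-I * z)‖ ≤ M := by
    refine PhragmenLindelof.right_half_plane_of_bounded_on_real (f := g)
      hgd.diffContOnCl ⟨0, by norm_num, 0, ?_⟩ ?_ ?_ (by simpa using hz)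
    · refine Asymptotics.IsBigO.of_bound K ?_
      refine Filter.eventually_inf_principal.2 (Filter.Eventually.of_forall fun w hw => ?_)
      simpa using hgb w (le_of_lt hw)
    · refine Filter.isBoundedUnder_of_eventually_le (a := K) ?_
      filter_upwards [Filter.eventually_ge_atTop 0] with x hx
      exact hgb x (by simpa using hx)
    · intro x
      rw [hnorm]
      have h1 : I * ((x : ℂ) * I) = ((-x : ℝ) : ℂ) := by
        push_cast
        linear_combination (x : ℂ) * I_mul_I
      rw [h1]
      simpa using hM (-x)
  rw [hnorm] at key
  have h1 : I * (-I * z) = z := by linear_combination (-z) * I_mul_I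
  have h2 : (-I * z).re = z.im := by simp
  rw [h1, h2] at key
  calc ‖f z‖ = (Real.exp (-(σ * z.im)) * ‖f z‖) * Real.exp (σ * z.im) := by
        rw [mul_right_comm, ← Real.exp_add]; simp
    _ ≤ _ := by gcongr

/-- An entire function of exponential type `σ` bounded by `M` on the real line is bounded by
`M exp (σ |Im z|)`. -/
theorem norm_le_of_exponential_type {E : Type*} [NormedAddCommGroup E]
    [NormedSpace ℂ E] {f : ℂ → E} (hf : Differentiable ℂ f) {K σ M : ℝ}
    (hK : ∀ z : ℂ, ‖f z‖ ≤ K * Real.exp (σ * |z.im|)) (hM : ∀ x : ℝ, ‖f x‖ ≤ M) (z : ℂ) :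
    ‖f z‖ ≤ M * Real.exp (σ * |z.im|) := by
  rcases le_total 0 z.im with hz | hz
  · rw [abs_of_nonneg hz]
    exact norm_le_of_exponential_type_of_im_nonneg hf hK hM hz
  · have := norm_le_of_exponential_type_of_im_nonneg (f := fun z => f (-z))
      (hf.comp differentiable_neg) (K := K) (M := M) (fun w => by simpa using hK (-w))
      (fun x => by simpa using hM (-x)) (z := -z) (by simpa using hz)
    rw [abs_of_nonpos hz]
    simpa using this

/-- Bernstein's inequality, up to a constant, in a strip around the real line. -/
theorem norm_deriv_le_of_exponential_type {E : Type*} [NormedAddCommGroup E]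
    [NormedSpace ℂ E] {f : ℂ → E} (hf : Differentiable ℂ f) {K σ M : ℝ} (hσ : 0 < σ)
    (hK : ∀ z : ℂ, ‖f z‖ ≤ K * Real.exp (σ * |z.im|)) (hM : ∀ x : ℝ, ‖f x‖ ≤ M) {z : ℂ}
    (hz : |z.im| ≤ σ⁻¹) : ‖deriv f z‖ ≤ σ * (Real.exp 2 * M) := by
  have hM0 : 0 ≤ M := (norm_nonneg _).trans (hM 0)
  -- Cauchy's estimate: the circle stays in the strip `|Im w| ≤ 2/σ`, where the growth factor is at
  -- most `exp 2`.
  have h := Complex.norm_deriv_le_of_forall_mem_sphere_norm_le (c := z) (R := σ⁻¹)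
    (C := Real.exp 2 * M) (f := f) (inv_pos.2 hσ) hf.diffContOnCl ?_
  · rwa [div_inv_eq_mul, mul_comm] at h
  · intro w hw
    have h1 : |w.im| ≤ 2 * σ⁻¹ := by
      have h2 : |(w - z).im| ≤ σ⁻¹ := by
        have := Complex.abs_im_le_norm (w - z)
        rw [mem_sphere_iff_norm] at hw
        linarith
      have h3 : w.im = (w - z).im + z.im := by simp
      have := abs_add_le (w - z).im z.im
      rw [← h3] at this
      linarith
    have h4 : σ * |w.im| ≤ 2 := by
      calc σ * |w.im| ≤ σ * (2 * σ⁻¹) := by gcongr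
        _ = 2 := by field_simp
    calc ‖f w‖ ≤ M * Real.exp (σ * |w.im|) := norm_le_of_exponential_type hf hK hM w
      _ ≤ M * Real.exp 2 := by gcongr
      _ = _ := mul_comm _ _

/-- A second Cauchy estimate. The circle of radius `σ⁻¹` about a real point lies in the strip where
the first derivative is already bounded, so `exp 2` enters only once. -/
theorem norm_deriv_deriv_le_of_exponential_type {E : Type*} [NormedAddCommGroup E]
    [NormedSpace ℂ E] [CompleteSpace E] {f : ℂ → E} (hf : Differentiable ℂ f) {K σ M : ℝ}
    (hσ : 0 < σ)
    (hK : ∀ z : ℂ, ‖f z‖ ≤ K * Real.exp (σ * |z.im|)) (hM : ∀ x : ℝ, ‖f x‖ ≤ M) {z : ℂ}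
    (hz : z.im = 0) : ‖deriv (deriv f) z‖ ≤ σ ^ 2 * (Real.exp 2 * M) := by
  have hd : Differentiable ℂ (deriv f) :=
    ((hf.contDiff (n := 2)).differentiable_deriv_two)
  have h := Complex.norm_deriv_le_of_forall_mem_sphere_norm_le (c := z) (R := σ⁻¹)
    (C := σ * (Real.exp 2 * M)) (f := deriv f) (inv_pos.2 hσ) hd.diffContOnCl ?_
  · rw [div_inv_eq_mul] at h
    linarith
  · intro w hw
    refine norm_deriv_le_of_exponential_type hf hσ hK hM ?_
    have := Complex.abs_im_le_norm (w - z)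
    rw [mem_sphere_iff_norm] at hw
    simpa [hz, hw] using this

/-- The domain for the mean value inequality: a complex-differentiable function is compared along a
real segment only. -/
theorem convex_real_segment (r : ℝ) : Convex ℝ {z : ℂ | z.im = 0 ∧ ‖z‖ ≤ r} := by
  have h1 : Convex ℝ {z : ℂ | z.im = 0} := by
    have := (convex_singleton (𝕜 := ℝ) (0 : ℝ)).linear_preimage Complex.imLm
    simpa [Set.preimage] using this
  have h2 : Convex ℝ {z : ℂ | ‖z‖ ≤ r} := by
    have := convex_closedBall (0 : ℂ) r
    simpa [Metric.closedBall, dist_eq_norm] using this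
  exact h1.inter h2

theorem norm_sub_le_of_exponential_type {E : Type*} [NormedAddCommGroup E]
    [NormedSpace ℂ E] {f : ℂ → E} (hf : Differentiable ℂ f) {K σ M : ℝ} (hσ : 0 < σ)
    (hK : ∀ z : ℂ, ‖f z‖ ≤ K * Real.exp (σ * |z.im|)) (hM : ∀ x : ℝ, ‖f x‖ ≤ M) (t : ℝ) :
    ‖f t - f 0‖ ≤ σ * (Real.exp 2 * M) * |t| := by
  have := (convex_real_segment |t|).norm_image_sub_le_of_norm_deriv_le (f := f)
    (C := σ * (Real.exp 2 * M)) (x := 0) (y := t) (fun z _ => hf z)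
    (fun z hz => norm_deriv_le_of_exponential_type hf hσ hK hM (by
      rw [hz.1, abs_zero]; positivity)) (by simp) (by simp)
  simpa using this

theorem norm_sub_le_add_of_exponential_type {E : Type*} [NormedAddCommGroup E]
    [NormedSpace ℂ E] [CompleteSpace E] {f : ℂ → E} (hf : Differentiable ℂ f) {K σ M : ℝ}
    (hσ : 0 < σ)
    (hK : ∀ z : ℂ, ‖f z‖ ≤ K * Real.exp (σ * |z.im|)) (hM : ∀ x : ℝ, ‖f x‖ ≤ M) (t : ℝ) :
    ‖f t - f 0‖ ≤ ‖deriv f 0‖ * |t| + σ ^ 2 * (Real.exp 2 * M) * t ^ 2 := by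
  have hM0 : 0 ≤ M := (norm_nonneg _).trans (hM 0)
  have hd : Differentiable ℂ (deriv f) :=
    ((hf.contDiff (n := 2)).differentiable_deriv_two)
  have h1 : ∀ z ∈ {z : ℂ | z.im = 0 ∧ ‖z‖ ≤ |t|},
      ‖deriv f z‖ ≤ ‖deriv f 0‖ + σ ^ 2 * (Real.exp 2 * M) * |t| := by
    intro z hz
    have := (convex_real_segment |t|).norm_image_sub_le_of_norm_deriv_le (f := deriv f)
      (C := σ ^ 2 * (Real.exp 2 * M)) (x := 0) (y := z) (fun z _ => hd z)
      (fun z hz => norm_deriv_deriv_le_of_exponential_type hf hσ hK hM hz.1) (by simp) hz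
    have h2 := norm_add_le (deriv f z - deriv f 0) (deriv f 0)
    rw [sub_add_cancel] at h2
    have h3 : σ ^ 2 * (Real.exp 2 * M) * ‖z - 0‖ ≤ σ ^ 2 * (Real.exp 2 * M) * |t| := by
      rw [sub_zero]
      exact mul_le_mul_of_nonneg_left hz.2 (by positivity)
    linarith
  have := (convex_real_segment |t|).norm_image_sub_le_of_norm_deriv_le (f := f)
    (x := 0) (y := t) (fun z _ => hf z) h1 (by simp) (by simp)
  refine this.trans (le_of_eq ?_)
  rw [sub_zero, Complex.norm_real, Real.norm_eq_abs, ← sq_abs t]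
  ring

end

/-! ### Restriction of a polynomial system to great circles. -/

noncomputable section

/-- The restriction of a polynomial system to the great circle through `x` and `y`, extended to
complex angles. -/
def circleSystem {n m : ℕ} (P : Fin m → MvPolynomial (Fin n) ℝ) (x y : EuclideanSpace ℝ (Fin n))
    (z : ℂ) : EuclideanSpace ℂ (Fin m) :=
  WithLp.toLp 2 fun j =>
    MvPolynomial.aeval (fun k => Complex.cos z * (x k : ℂ) + Complex.sin z * (y k : ℂ)) (P j)

theorem aeval_ofReal {n : ℕ} (p : MvPolynomial (Fin n) ℝ) (x : Fin n → ℝ) :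
    MvPolynomial.aeval (fun k => (x k : ℂ)) p = ((MvPolynomial.eval x p : ℝ) : ℂ) := by
  have := MvPolynomial.aeval_algebraMap_apply (A := ℝ) ℂ x p
  simpa [MvPolynomial.aeval_eq_eval, Function.comp_def] using this

theorem norm_circleSystem_ofReal {n m : ℕ} (P : Fin m → MvPolynomial (Fin n) ℝ)
    (x y : EuclideanSpace ℝ (Fin n)) (t : ℝ) :
    ‖circleSystem P x y t‖ = ‖evalSystem P (Real.cos t • x + Real.sin t • y)‖ := by
  rw [EuclideanSpace.norm_eq, EuclideanSpace.norm_eq]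
  congr 1
  refine Finset.sum_congr rfl fun j _ => ?_
  have : (circleSystem P x y t) j =
      ((evalSystem P (Real.cos t • x + Real.sin t • y) j : ℝ) : ℂ) := by
    simp only [circleSystem, evalSystem]
    rw [← aeval_ofReal]
    simp
  rw [this, Complex.norm_real]

theorem hasDerivAt_aeval {n : ℕ} (p : MvPolynomial (Fin n) ℝ) {g : ℂ → Fin n → ℂ}
    {g' : Fin n → ℂ} {z : ℂ} (hg : ∀ k, HasDerivAt (fun w => g w k) (g' k) z) :
    HasDerivAt (fun w => MvPolynomial.aeval (g w) p)
      (∑ k, MvPolynomial.aeval (g z) (MvPolynomial.pderiv k p) * g' k) z := by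
  induction p using MvPolynomial.induction_on with
  | C a => simpa using hasDerivAt_const z (a : ℂ)
  | add p q hp hq =>
    simp only [map_add, add_mul, Finset.sum_add_distrib]
    exact hp.add hq
  | mul_X p i hp =>
    have h := hp.mul (hg i)
    simp only [map_mul, MvPolynomial.aeval_X, Derivation.leibniz, MvPolynomial.pderiv_X,
      smul_eq_mul, map_add]
    refine h.congr_deriv ?_
    have h1 : ∀ k, (MvPolynomial.aeval (g z)) (Pi.single (M := fun _ => MvPolynomial (Fin n) ℝ)
        k 1 i) * g' k = if k = i then g' i else 0 := by
      intro k
      by_cases hk : k = i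
      · subst hk; simp
      · simp [hk, Ne.symm hk]
    simp only [add_mul, Finset.sum_add_distrib, mul_assoc, h1, Finset.sum_mul, ← Finset.mul_sum]
    rw [add_comm]
    congr 1
    · simp
    · rw [Finset.mul_sum]
      exact Finset.sum_congr rfl fun k _ => by ring

theorem hasDerivAt_circleSystem {n m : ℕ} (P : Fin m → MvPolynomial (Fin n) ℝ)
    (x y : EuclideanSpace ℝ (Fin n)) (z : ℂ) :
    HasDerivAt (circleSystem P x y) (WithLp.toLp 2 fun j =>
      ∑ k, MvPolynomial.aeval (fun k => Complex.cos z * (x k : ℂ) + Complex.sin z * (y k : ℂ))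
        (MvPolynomial.pderiv k (P j)) * (-Complex.sin z * x k + Complex.cos z * y k)) z := by
  have h : HasDerivAt (fun w => fun j => MvPolynomial.aeval
      (fun k => Complex.cos w * (x k : ℂ) + Complex.sin w * (y k : ℂ)) (P j)) (fun j =>
      ∑ k, MvPolynomial.aeval (fun k => Complex.cos z * (x k : ℂ) + Complex.sin z * (y k : ℂ))
        (MvPolynomial.pderiv k (P j)) * (-Complex.sin z * x k + Complex.cos z * y k)) z :=
    hasDerivAt_pi.2 fun j => hasDerivAt_aeval (P j) fun k =>
      ((Complex.hasDerivAt_cos z).mul_const _).add ((Complex.hasDerivAt_sin z).mul_const _)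
  exact ((PiLp.continuousLinearEquiv 2 ℂ fun _ : Fin m => ℂ).symm.toContinuousLinearMap
    |>.hasFDerivAt.comp_hasDerivAt z h)

theorem norm_deriv_circleSystem_zero {n m : ℕ} (P : Fin m → MvPolynomial (Fin n) ℝ)
    (x y : EuclideanSpace ℝ (Fin n)) :
    ‖deriv (circleSystem P x y) 0‖ = ‖jacobianApply P x y‖ := by
  rw [(hasDerivAt_circleSystem P x y 0).deriv, EuclideanSpace.norm_eq, EuclideanSpace.norm_eq]
  congr 1
  refine Finset.sum_congr rfl fun j _ => ?_
  rw [← Complex.norm_real]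
  simp [jacobianApply, aeval_ofReal]

theorem norm_cos_le_exp (z : ℂ) : ‖Complex.cos z‖ ≤ Real.exp |z.im| := by
  rw [Complex.cos, norm_div]
  have h1 : ‖Complex.exp (z * Complex.I)‖ ≤ Real.exp |z.im| := by
    rw [Complex.norm_exp]
    simpa using neg_le_abs z.im
  have h2 : ‖Complex.exp (-z * Complex.I)‖ ≤ Real.exp |z.im| := by
    rw [Complex.norm_exp]
    simpa using le_abs_self z.im
  have := norm_add_le (Complex.exp (z * Complex.I)) (Complex.exp (-z * Complex.I))
  rw [Complex.norm_two]
  linarith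

theorem norm_sin_le_exp (z : ℂ) : ‖Complex.sin z‖ ≤ Real.exp |z.im| := by
  rw [Complex.sin, norm_div, norm_mul, Complex.norm_I, mul_one]
  have h1 : ‖Complex.exp (z * Complex.I)‖ ≤ Real.exp |z.im| := by
    rw [Complex.norm_exp]
    simpa using neg_le_abs z.im
  have h2 : ‖Complex.exp (-z * Complex.I)‖ ≤ Real.exp |z.im| := by
    rw [Complex.norm_exp]
    simpa using le_abs_self z.im
  have := norm_sub_le (Complex.exp (-z * Complex.I)) (Complex.exp (z * Complex.I))
  rw [Complex.norm_two]
  linarith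

theorem norm_aeval_le_pow {n D : ℕ} (p : MvPolynomial (Fin n) ℝ) (hp : p.totalDegree ≤ D)
    {g : Fin n → ℂ} {B : ℝ} (hB : 1 ≤ B) (hg : ∀ k, ‖g k‖ ≤ B) :
    ‖MvPolynomial.aeval g p‖ ≤ (∑ s ∈ p.support, |p.coeff s|) * B ^ D := by
  rw [MvPolynomial.aeval_def, MvPolynomial.eval₂_eq', Finset.sum_mul]
  refine (norm_sum_le _ _).trans (Finset.sum_le_sum fun s hs => ?_)
  rw [norm_mul, norm_prod, norm_algebraMap', Real.norm_eq_abs]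
  gcongr
  calc ∏ k, ‖g k ^ s k‖ ≤ ∏ k, B ^ s k := by
        gcongr with k
        rw [norm_pow]
        gcongr
        exact hg k
    _ = B ^ (∑ k, s k) := Finset.prod_pow_eq_pow_sum _ _ _
    _ ≤ B ^ D := by
        refine pow_le_pow_right₀ hB (le_trans ?_ hp)
        have := MvPolynomial.le_totalDegree hs
        rwa [Finsupp.sum_fintype _ _ (by simp)] at this

theorem norm_le_sum_norm_apply {m : ℕ} (v : EuclideanSpace ℂ (Fin m)) : ‖v‖ ≤ ∑ j, ‖v j‖ := by
  rw [EuclideanSpace.norm_eq]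
  refine Real.sqrt_le_iff.2 ⟨by positivity, ?_⟩
  exact Finset.sum_sq_le_sq_sum_of_nonneg fun j _ => norm_nonneg _

/-- Since `cos z` and `sin z` are at most `exp |Im z|`, degree at most `D` gives exponential type
`D`. The size of `K` is immaterial: it does not enter the Bernstein bounds. -/
theorem exists_norm_circleSystem_le {n m D : ℕ} (P : Fin m → MvPolynomial (Fin n) ℝ)
    (hP : ∀ j, (P j).totalDegree ≤ D) (x y : EuclideanSpace ℝ (Fin n)) :
    ∃ K : ℝ, ∀ z : ℂ, ‖circleSystem P x y z‖ ≤ K * Real.exp (D * |z.im|) := by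
  set R : ℝ := ‖x‖ + ‖y‖ + 1 with hR
  have hR1 : 1 ≤ R := by
    have := norm_nonneg x
    have := norm_nonneg y
    linarith
  refine ⟨∑ j, (∑ s ∈ (P j).support, |(P j).coeff s|) * R ^ D, fun z => ?_⟩
  have he : 1 ≤ Real.exp |z.im| := Real.one_le_exp (abs_nonneg _)
  refine (norm_le_sum_norm_apply _).trans ?_
  rw [Finset.sum_mul]
  refine Finset.sum_le_sum fun j _ => ?_
  refine (norm_aeval_le_pow (P j) (hP j) (B := R * Real.exp |z.im|)
    (one_le_mul_of_one_le_of_one_le hR1 he) fun k => ?_).trans (le_of_eq ?_)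
  · have hx : |x k| ≤ ‖x‖ := PiLp.norm_apply_le x k
    have hy : |y k| ≤ ‖y‖ := PiLp.norm_apply_le y k
    calc _ ≤ ‖Complex.cos z‖ * |x k| + ‖Complex.sin z‖ * |y k| := by
          refine (norm_add_le _ _).trans (le_of_eq ?_)
          simp
      _ ≤ Real.exp |z.im| * ‖x‖ + Real.exp |z.im| * ‖y‖ := by
          gcongr
          · exact norm_cos_le_exp z
          · exact norm_sin_le_exp z
      _ ≤ R * Real.exp |z.im| := by rw [hR]; nlinarith
  · rw [mul_pow, ← Real.exp_nat_mul, mul_assoc]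

theorem norm_cos_smul_add_sin_smul {n : ℕ} {x y : EuclideanSpace ℝ (Fin n)} (hx : ‖x‖ = 1)
    (hy : ‖y‖ = 1) (hxy : inner ℝ x y = 0) (t : ℝ) :
    ‖Real.cos t • x + Real.sin t • y‖ = 1 := by
  have h := norm_add_sq_real (Real.cos t • x) (Real.sin t • y)
  rw [inner_smul_left, inner_smul_right, hxy, norm_smul, norm_smul, hx, hy] at h
  simp only [mul_zero, add_zero, mul_one, Real.norm_eq_abs, sq_abs,
    Real.cos_sq_add_sin_sq] at h
  have := norm_nonneg (Real.cos t • x + Real.sin t • y)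
  exact (sq_eq_sq₀ this zero_le_one).1 (by rw [h, one_pow])

theorem differentiable_circleSystem {n m : ℕ} (P : Fin m → MvPolynomial (Fin n) ℝ)
    (x y : EuclideanSpace ℝ (Fin n)) : Differentiable ℂ (circleSystem P x y) :=
  fun z => (hasDerivAt_circleSystem P x y z).differentiableAt

/-- Growth of a polynomial system along a great circle, to first order. -/
theorem norm_evalSystem_great_circle_le {n m D : ℕ} (hD : 1 ≤ D)
    (P : Fin m → MvPolynomial (Fin n) ℝ) (hP : ∀ j, (P j).totalDegree ≤ D) {M : ℝ}
    (hM : ∀ x, ‖x‖ = 1 → ‖evalSystem P x‖ ≤ M) {x y : EuclideanSpace ℝ (Fin n)} (hx : ‖x‖ = 1)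
    (hy : ‖y‖ = 1) (hxy : inner ℝ x y = 0) (t : ℝ) :
    ‖evalSystem P (Real.cos t • x + Real.sin t • y)‖ ≤
      ‖evalSystem P x‖ + D * (Real.exp 2 * M) * |t| := by
  obtain ⟨K, hK⟩ := exists_norm_circleSystem_le P hP x y
  have h := norm_sub_le_of_exponential_type (differentiable_circleSystem P x y) (M := M)
    (by positivity) hK (fun t => by
      rw [norm_circleSystem_ofReal]
      exact hM _ (norm_cos_smul_add_sin_smul hx hy hxy t)) t
  have h0 : ‖circleSystem P x y 0‖ = ‖evalSystem P x‖ := by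
    simpa using norm_circleSystem_ofReal P x y 0
  rw [← norm_circleSystem_ofReal, ← h0]
  linarith [norm_le_norm_add_norm_sub' (circleSystem P x y t) (circleSystem P x y 0)]

/-- Growth of a polynomial system along a great circle, to second order. -/
theorem norm_evalSystem_great_circle_le_jacobian {n m D : ℕ} (hD : 1 ≤ D)
    (P : Fin m → MvPolynomial (Fin n) ℝ) (hP : ∀ j, (P j).totalDegree ≤ D) {M : ℝ}
    (hM : ∀ x, ‖x‖ = 1 → ‖evalSystem P x‖ ≤ M) {x y : EuclideanSpace ℝ (Fin n)} (hx : ‖x‖ = 1)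
    (hy : ‖y‖ = 1) (hxy : inner ℝ x y = 0) (t : ℝ) :
    ‖evalSystem P (Real.cos t • x + Real.sin t • y)‖ ≤
      ‖evalSystem P x‖ + ‖jacobianApply P x y‖ * |t| + D ^ 2 * (Real.exp 2 * M) * t ^ 2 := by
  obtain ⟨K, hK⟩ := exists_norm_circleSystem_le P hP x y
  have h := norm_sub_le_add_of_exponential_type (differentiable_circleSystem P x y) (M := M)
    (by positivity) hK (fun t => by
      rw [norm_circleSystem_ofReal]
      exact hM _ (norm_cos_smul_add_sin_smul hx hy hxy t)) t
  have h0 : ‖circleSystem P x y 0‖ = ‖evalSystem P x‖ := by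
    simpa using norm_circleSystem_ofReal P x y 0
  rw [norm_deriv_circleSystem_zero] at h
  rw [← norm_circleSystem_ofReal, ← h0]
  linarith [norm_le_norm_add_norm_sub' (circleSystem P x y t) (circleSystem P x y 0)]

end

/-! ### Elongated patches on which the system stays small. -/

noncomputable section

open MeasureTheory Metric

theorem abs_arctan_le_abs (u : ℝ) : |Real.arctan u| ≤ |u| := by
  have h : ∀ v : ℝ, 0 ≤ v → Real.arctan v ≤ v := fun v hv => by
    have h1 := Real.le_tan (x := Real.arctan v) (Real.arctan_nonneg.2 hv)
      (Real.arctan_lt_pi_div_two v)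
    rwa [Real.tan_arctan] at h1
  rcases le_total 0 u with hu | hu
  · rw [abs_of_nonneg hu, abs_of_nonneg (Real.arctan_nonneg.2 hu)]
    exact h u hu
  · have h1 := h (-u) (by linarith)
    rw [Real.arctan_neg] at h1
    rw [abs_of_nonpos hu, abs_of_nonpos (Real.arctan_le_zero.2 hu)]
    exact h1

/-- Polar coordinates in the plane of `x` and `y`. -/
theorem exists_polar {E : Type*} [AddCommGroup E] [Module ℝ E] (x y : E) {p : ℝ} (hp : 0 < p)
    (q : ℝ) : ∃ t r : ℝ, p ≤ r ∧ |t| ≤ |q| / p ∧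
      p • x + q • y = r • (Real.cos t • x + Real.sin t • y) := by
  have hs : 0 < √(1 + (q / p) ^ 2) := Real.sqrt_pos.2 (by positivity)
  refine ⟨Real.arctan (q / p), p * √(1 + (q / p) ^ 2), ?_, ?_, ?_⟩
  · refine le_mul_of_one_le_right hp.le (Real.one_le_sqrt.2 ?_)
    linarith [sq_nonneg (q / p)]
  · refine (abs_arctan_le_abs _).trans (le_of_eq ?_)
    rw [abs_div, abs_of_pos hp]
  · rw [Real.cos_arctan, Real.sin_arctan, smul_add, smul_smul, smul_smul]
    congr 2
    · field_simp
    · field_simp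

theorem inv_norm_smul_of_pos {E : Type*} [NormedAddCommGroup E] [NormedSpace ℝ E] {u w : E}
    {r : ℝ} (hr : 0 < r) (hu : ‖u‖ = 1) (hw : w = r • u) : ‖w‖⁻¹ • w = u := by
  rw [hw, norm_smul, hu, mul_one, Real.norm_of_nonneg hr.le, smul_smul, inv_mul_cancel₀ hr.ne',
    one_smul]

/-- A polynomial system that is small at `x`, with small derivative in direction `y`, is small at
all points of a neighbourhood of `x` that is elongated in the direction of `y`. -/
theorem norm_evalSystem_normalized_le {n m D : ℕ} (hD : 1 ≤ D)
    (P : Fin m → MvPolynomial (Fin n) ℝ) (hP : ∀ j, (P j).totalDegree ≤ D) {M : ℝ}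
    (hM : ∀ x, ‖x‖ = 1 → ‖evalSystem P x‖ ≤ M) {x y z : EuclideanSpace ℝ (Fin n)} (hx : ‖x‖ = 1)
    (hy : ‖y‖ = 1) (hxy : inner ℝ x y = 0) (hxz : inner ℝ x z = 0) (hyz : inner ℝ y z = 0)
    {p q β ε : ℝ} (hp : 0 < p) (hβ : |q| ≤ β * p) (hε : ‖z‖ ≤ ε * p) :
    ‖evalSystem P (‖p • x + q • y + z‖⁻¹ • (p • x + q • y + z))‖ ≤
      ‖evalSystem P x‖ + ‖jacobianApply P x y‖ * β + D ^ 2 * (Real.exp 2 * M) * β ^ 2 +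
        D * (Real.exp 2 * M) * ε := by
  have hM0 : 0 ≤ M := (norm_nonneg _).trans (hM x hx)
  obtain ⟨t, r, hr, ht, hu⟩ := exists_polar x y hp q
  set u := Real.cos t • x + Real.sin t • y with hu_def
  have htβ : |t| ≤ β := ht.trans ((div_le_iff₀ hp).2 hβ)
  have hu1 : ‖u‖ = 1 := norm_cos_smul_add_sin_smul hx hy hxy t
  have h1 : ‖evalSystem P u‖ ≤ ‖evalSystem P x‖ + ‖jacobianApply P x y‖ * β +
      D ^ 2 * (Real.exp 2 * M) * β ^ 2 := by
    refine (norm_evalSystem_great_circle_le_jacobian hD P hP hM hx hy hxy t).trans ?_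
    rw [← sq_abs t]
    gcongr
  have hε0 : 0 ≤ ε := by
    by_contra h
    have := mul_neg_of_neg_of_pos (not_le.1 h) hp
    linarith [norm_nonneg z]
  rw [hu]
  have hr0 : 0 < r := hp.trans_le hr
  by_cases hz : z = 0
  · rw [hz, add_zero, inv_norm_smul_of_pos hr0 hu1 rfl]
    have : 0 ≤ D * (Real.exp 2 * M) * ε := by positivity
    linarith
  · have hz0 : 0 < ‖z‖ := norm_pos_iff.2 hz
    set v := ‖z‖⁻¹ • z with hv
    have hv1 : ‖v‖ = 1 := norm_smul_inv_norm hz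
    have huv : inner ℝ u v = 0 := by
      rw [hu_def, hv, inner_smul_right, inner_add_left, inner_smul_left, inner_smul_left, hxz, hyz]
      simp
    have hzv : z = ‖z‖ • v := by
      rw [hv, smul_smul, mul_inv_cancel₀ hz0.ne', one_smul]
    obtain ⟨s, r', hr', hs, hw⟩ := exists_polar u v hr0 ‖z‖
    have hsε : |s| ≤ ε := by
      refine hs.trans ((div_le_iff₀ hr0).2 ?_)
      rw [abs_of_pos hz0]
      exact hε.trans (by gcongr)
    rw [inv_norm_smul_of_pos (hr0.trans_le hr') (norm_cos_smul_add_sin_smul hu1 hv1 huv s)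
      (by rw [← hw, ← hzv])]
    refine (norm_evalSystem_great_circle_le hD P hP hM hu1 hv1 huv s).trans ?_
    gcongr

/-- The linear map that fixes `x` and scales `y` by `β` and the complement by `ε`. -/
def planarScaling {E : Type*} [NormedAddCommGroup E] [InnerProductSpace ℝ E] (x y : E) (β ε : ℝ) :
    E →ₗ[ℝ] E :=
  (innerₛₗ ℝ x).smulRight x + β • (innerₛₗ ℝ y).smulRight y +
    ε • (LinearMap.id - (innerₛₗ ℝ x).smulRight x - (innerₛₗ ℝ y).smulRight y)

theorem planarScaling_apply {E : Type*} [NormedAddCommGroup E] [InnerProductSpace ℝ E] (x y : E)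
    (β ε : ℝ) (v : E) : planarScaling x y β ε v =
      inner ℝ x v • x + (β * inner ℝ y v) • y +
        ε • (v - inner ℝ x v • x - inner ℝ y v • y) := by
  simp [planarScaling, smul_smul]

/-- In an orthonormal basis starting with `x`, `y` the map is diagonal with entries `1, β, ε, …, ε`.
-/
theorem det_planarScaling {k : ℕ} {x y : EuclideanSpace ℝ (Fin (k + 2))} (hx : ‖x‖ = 1)
    (hy : ‖y‖ = 1) (hxy : inner ℝ x y = 0) (β ε : ℝ) :
    LinearMap.det (planarScaling x y β ε) = β * ε ^ k := by
  set v : Fin (k + 2) → EuclideanSpace ℝ (Fin (k + 2)) := Fin.cons x (Fin.cons y fun _ => 0) with hv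
  have hyx : inner ℝ y x = 0 := by rw [real_inner_comm]; exact hxy
  have hxx : inner ℝ x x = 1 := by rw [real_inner_self_eq_norm_sq, hx]; norm_num
  have hyy : inner ℝ y y = 1 := by rw [real_inner_self_eq_norm_sq, hy]; norm_num
  have hon : Orthonormal ℝ (Set.domRestrict ({0, 1} : Set (Fin (k + 2))) v) := by
    rw [orthonormal_iff_ite]
    rintro ⟨i, rfl | rfl⟩ ⟨j, rfl | rfl⟩ <;> simp [v, hxy, hyx, hx, hy, Subtype.ext_iff]
  obtain ⟨b, hb⟩ := hon.exists_orthonormalBasis_extension_of_card_eq (by simp)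
  have hb0 : b 0 = x := hb 0 (by simp)
  have hb1 : b 1 = y := hb 1 (by simp)
  have hb_in : ∀ i j, inner ℝ (b i) (b j) = if i = j then (1 : ℝ) else 0 :=
    orthonormal_iff_ite.1 b.orthonormal
  have key : LinearMap.toMatrix b.toBasis b.toBasis (planarScaling x y β ε) =
      Matrix.diagonal (Fin.cons 1 (Fin.cons β fun _ => ε)) := by
    ext i j
    rw [LinearMap.toMatrix_apply, planarScaling_apply, OrthonormalBasis.coe_toBasis, ← hb0, ← hb1,
      hb_in, hb_in]
    simp only [map_add, map_sub, map_smul, Matrix.diagonal_apply]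
    refine Fin.cases ?_ (fun j => Fin.cases ?_ (fun j => ?_) j) j
    · by_cases hi : i = 0 <;> simp [hi]
    · by_cases hi : i = 1 <;> simp [hi]
    · have h1 : (1 : Fin (k + 2)) ≠ j.succ.succ := by
        rw [← Fin.succ_zero_eq_one, Ne, Fin.succ_inj]
        exact (Fin.succ_ne_zero j).symm
      have h0 : (0 : Fin (k + 2)) ≠ j.succ.succ := (Fin.succ_ne_zero _).symm
      by_cases hi : i = j.succ.succ <;> simp [hi, h1, h0]
  rw [← LinearMap.det_toMatrix b.toBasis, key, Matrix.det_diagonal, Fin.prod_univ_succ,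
    Fin.prod_univ_succ]
  simp

/-- If the system and its derivative in direction `y` are small at `x`, then the radial extension of
the system is small on a set of volume proportional to `β ^ (2 * n - 3)`, where `n = k + 2`. -/
theorem exists_patch {k m D : ℕ} (hD : 1 ≤ D)
    (P : Fin m → MvPolynomial (Fin (k + 2)) ℝ) (hP : ∀ j, (P j).totalDegree ≤ D) {M : ℝ}
    (hM : ∀ x, ‖x‖ = 1 → ‖evalSystem P x‖ ≤ M) {x y : EuclideanSpace ℝ (Fin (k + 2))}
    (hx : ‖x‖ = 1) (hy : ‖y‖ = 1) (hxy : inner ℝ x y = 0) {β : ℝ} (hβ : 0 < β) (hβ8 : β ^ 2 ≤ 8) :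
    ∃ S ⊆ ball (0 : EuclideanSpace ℝ (Fin (k + 2))) 8,
      volume S = ENNReal.ofReal (β * (β ^ 2) ^ k) *
        volume (ball (0 : EuclideanSpace ℝ (Fin (k + 2))) (1 / 2)) ∧
      ∀ w ∈ S, ‖evalSystem P (‖w‖⁻¹ • w)‖ ≤
        ‖evalSystem P x‖ + ‖jacobianApply P x y‖ * β +
          2 * (D ^ 2 * (Real.exp 2 * M) * β ^ 2) := by
  have hM0 : 0 ≤ M := (norm_nonneg _).trans (hM x hx)
  have hxx : inner ℝ x x = 1 := by rw [real_inner_self_eq_norm_sq, hx]; norm_num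
  have hyy : inner ℝ y y = 1 := by rw [real_inner_self_eq_norm_sq, hy]; norm_num
  have hyx : inner ℝ y x = 0 := by rw [real_inner_comm]; exact hxy
  have hcoord : ∀ v ∈ ball x (1 / 2), |inner ℝ x v - 1| ≤ 1 / 2 ∧ |inner ℝ y v| ≤ 1 / 2 ∧
      ‖v - inner ℝ x v • x - inner ℝ y v • y‖ ≤ 1 / 2 := by
    intro v hv
    rw [mem_ball_iff_norm] at hv
    set h := v - x with hh
    have hvx : v = x + h := by rw [hh]; abel
    have h1 : inner ℝ x v = 1 + inner ℝ x h := by rw [hvx, inner_add_right, hxx]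
    have h2 : inner ℝ y v = inner ℝ y h := by rw [hvx, inner_add_right, hyx, zero_add]
    refine ⟨?_, ?_, ?_⟩
    · rw [h1, add_sub_cancel_left]
      have := abs_real_inner_le_norm x h
      rw [hx, one_mul] at this
      linarith
    · rw [h2]
      have := abs_real_inner_le_norm y h
      rw [hy, one_mul] at this
      linarith
    · have h3 : v - inner ℝ x v • x - inner ℝ y v • y = h - inner ℝ x h • x - inner ℝ y h • y := by
        rw [h1, h2, hvx, add_smul, one_smul]
        abel
      rw [h3]
      have h4 : ‖h - inner ℝ x h • x - inner ℝ y h • y‖ ^ 2 =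
          ‖h‖ ^ 2 - inner ℝ x h ^ 2 - inner ℝ y h ^ 2 := by
        rw [← real_inner_self_eq_norm_sq, ← real_inner_self_eq_norm_sq]
        simp only [inner_sub_left, inner_sub_right, inner_smul_left, inner_smul_right, hxx, hyy,
          hxy, hyx, real_inner_comm x h, real_inner_comm y h]
        simp only [conj_trivial]
        ring
      have h5 : ‖h - inner ℝ x h • x - inner ℝ y h • y‖ ^ 2 ≤ ‖h‖ ^ 2 := by
        rw [h4]
        linarith [sq_nonneg (inner ℝ x h), sq_nonneg (inner ℝ y h)]
      exact (pow_le_pow_iff_left₀ (norm_nonneg _) (norm_nonneg _) two_ne_zero).1 h5 |>.trans hv.le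
  have hβ3 : β ≤ 3 := by nlinarith
  -- On `ball x (1 / 2)` the `x`-coordinate is at least `1/2` and the other components at most
  -- `1/2`, so after scaling their ratios to it are at most `β` and `β ^ 2`. The image has norm at
  -- most `3/2 + 3/2 + 4 < 8`.
  refine ⟨planarScaling x y β (β ^ 2) '' ball x (1 / 2), ?_, ?_, ?_⟩
  · rintro _ ⟨v, hv, rfl⟩
    obtain ⟨h1, h2, h3⟩ := hcoord v hv
    rw [mem_ball_zero_iff, planarScaling_apply]
    refine (norm_add₃_le).trans_lt ?_
    rw [norm_smul, norm_smul, norm_smul, hx, hy, Real.norm_eq_abs, Real.norm_eq_abs,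
      Real.norm_eq_abs, abs_mul, abs_of_pos hβ, abs_of_pos (by positivity : 0 < β ^ 2)]
    have h4 : |inner ℝ x v| ≤ 3 / 2 := by
      rw [abs_le] at h1 ⊢
      constructor <;> linarith [h1.1, h1.2]
    have h5 : β * |inner ℝ y v| ≤ 3 * (1 / 2) := by gcongr
    have h6 : β ^ 2 * ‖v - inner ℝ x v • x - inner ℝ y v • y‖ ≤ 8 * (1 / 2) := by gcongr
    linarith
  · rw [Measure.addHaar_image_linearMap, det_planarScaling hx hy hxy,
      abs_of_pos (by positivity), Measure.addHaar_ball_center]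
  · rintro _ ⟨v, hv, rfl⟩
    obtain ⟨h1, h2, h3⟩ := hcoord v hv
    have hp : 1 / 2 ≤ inner ℝ x v := by
      rw [abs_le] at h1
      linarith [h1.1]
    rw [planarScaling_apply]
    refine (norm_evalSystem_normalized_le hD P hP hM hx hy hxy (β := β) (ε := β ^ 2) ?_ ?_
      (by linarith) ?_ ?_).trans ?_
    · rw [inner_smul_right, inner_sub_right, inner_sub_right, inner_smul_right, inner_smul_right,
        hxx, hxy]
      ring
    · rw [inner_smul_right, inner_sub_right, inner_sub_right, inner_smul_right, inner_smul_right,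
        hyx, hyy]
      ring
    · rw [abs_mul, abs_of_pos hβ]
      gcongr
      exact h2.trans hp
    · rw [norm_smul, Real.norm_of_nonneg (by positivity)]
      gcongr
      exact h3.trans hp
    -- With width `β ^ 2`, the first-order transversal error is absorbed by a second copy of the
    -- second-order error along `y`.
    · have h4 : (D : ℝ) ≤ (D : ℝ) ^ 2 := by
        have : (1 : ℝ) ≤ D := by exact_mod_cast hD
        nlinarith
      have h5 : D * (Real.exp 2 * M) * β ^ 2 ≤ D ^ 2 * (Real.exp 2 * M) * β ^ 2 := by gcongr
      linarith

end

/-! ### Small ball estimate for the value of the random system at a point. -/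

noncomputable section

open MeasureTheory ProbabilityTheory

/-- The vector of coefficients of the linear functional `c ↦ weylForm c x`. -/
def weylVector {n : ℕ} (d : ℕ) (x : EuclideanSpace ℝ (Fin n)) :
    EuclideanSpace ℝ (ExponentIndex n d) :=
  WithLp.toLp 2 fun a => √(Nat.multinomial Finset.univ a.1 : ℝ) * ∏ k, x k ^ a.1 k

theorem eval_weylForm {n d : ℕ} (c : EuclideanSpace ℝ (ExponentIndex n d))
    (x : EuclideanSpace ℝ (Fin n)) :
    MvPolynomial.eval (fun k => x k) (weylForm c) = inner ℝ (weylVector d x) c := by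
  rw [weylForm, map_sum, PiLp.inner_apply]
  refine Finset.sum_congr rfl fun a _ => ?_
  rw [MvPolynomial.eval_monomial, Finsupp.prod_fintype _ _ (by simp)]
  simp only [weylVector, Finsupp.equivFunOnFinite_symm_apply_apply, RCLike.inner_apply,
    conj_trivial]
  ring

/-- The multinomial theorem. This is what the weights `√(d choose a)` are for: evaluation at every
unit vector has norm one, so the small ball bound is the same at all points of the sphere. -/
theorem norm_weylVector {n d : ℕ} (x : EuclideanSpace ℝ (Fin n)) :
    ‖weylVector d x‖ = ‖x‖ ^ d := by
  have h : ‖weylVector d x‖ ^ 2 = (‖x‖ ^ d) ^ 2 := by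
    rw [EuclideanSpace.norm_sq_eq, ← pow_mul, mul_comm d 2, pow_mul, EuclideanSpace.norm_sq_eq,
      Finset.sum_pow_eq_sum_piAntidiag, ← Finset.sum_coe_sort (Finset.piAntidiag _ _)]
    refine Finset.sum_congr rfl fun a _ => ?_
    simp only [weylVector, Real.norm_eq_abs, sq_abs]
    rw [mul_pow, Real.sq_sqrt (Nat.cast_nonneg _), ← Finset.prod_pow]
    congr 1
    exact Finset.prod_congr rfl fun k _ => by rw [← pow_mul, ← pow_mul, mul_comm]
  exact (sq_eq_sq₀ (norm_nonneg _) (by positivity)).1 h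

theorem totalDegree_weylForm_le {n d : ℕ} (c : EuclideanSpace ℝ (ExponentIndex n d)) :
    (weylForm c).totalDegree ≤ d := by
  refine MvPolynomial.totalDegree_finsetSum_le fun a _ => ?_
  refine (MvPolynomial.totalDegree_monomial_le _ _).trans ?_
  have := (Finset.mem_piAntidiag.1 a.2).1
  rw [Finsupp.sum_fintype _ _ (by simp)]
  simpa using this.le

theorem tsum_half_pow_mul_succ (c : ℝ) (hc : 0 ≤ c) :
    ∑' k : ℕ, (2⁻¹ : ENNReal) ^ k * ENNReal.ofReal (c * ((k + 1 : ℕ) : ℝ)) =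
      ENNReal.ofReal (4 * c) := by
  have h1 : HasSum (fun k : ℕ => (k : ℝ) * (1 / 2 : ℝ) ^ k) 2 := by
    have := hasSum_coe_mul_geometric_of_norm_lt_one (𝕜 := ℝ) (r := 1 / 2) (by norm_num)
    convert! this using 1
    norm_num
  have h2 := (h1.add hasSum_geometric_two).mul_left c
  have h3 : ∀ k : ℕ, (2⁻¹ : ENNReal) ^ k * ENNReal.ofReal (c * ((k + 1 : ℕ) : ℝ)) =
      ENNReal.ofReal (c * ((k : ℝ) * (1 / 2 : ℝ) ^ k + (1 / 2 : ℝ) ^ k)) := by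
    intro k
    have h4 : (2⁻¹ : ENNReal) = ENNReal.ofReal (1 / 2) := by
      rw [one_div, ENNReal.ofReal_inv_of_pos two_pos]
      simp
    rw [h4, ← ENNReal.ofReal_pow (by norm_num), ← ENNReal.ofReal_mul (by positivity)]
    congr 1
    push_cast
    ring
  simp_rw [h3]
  rw [← ENNReal.ofReal_tsum_of_nonneg (fun k => by positivity) h2.summable, h2.tsum_eq]
  congr 1
  ring

/-- A step function that is at least `2⁻ᵏ` at `u`, for `k = ⌊|u| / s⌋`. -/
def dyadicWeight (s u : ℝ) : ENNReal :=
  ∑' k : ℕ, (2⁻¹ : ENNReal) ^ k * {v : ℝ | |v| ≤ s * ((k + 1 : ℕ) : ℝ)}.indicator 1 u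

theorem measurableSet_abs_le (r : ℝ) : MeasurableSet {v : ℝ | |v| ≤ r} :=
  measurableSet_le (by fun_prop) measurable_const

theorem measurable_dyadicWeight (s : ℝ) : Measurable (dyadicWeight s) := by
  refine Measurable.tsum fun k => Measurable.const_mul ?_ _
  exact measurable_one.indicator (measurableSet_abs_le _)

theorem le_dyadicWeight {s : ℝ} (hs : 0 < s) (u : ℝ) :
    (2⁻¹ : ENNReal) ^ ⌊|u| / s⌋₊ ≤ dyadicWeight s u := by
  refine le_trans (le_of_eq ?_) (ENNReal.le_tsum ⌊|u| / s⌋₊)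
  rw [Set.indicator_of_mem, Pi.one_apply, mul_one]
  have := (Nat.lt_floor_add_one (|u| / s)).le
  rw [div_le_iff₀ hs] at this
  simp only [Set.mem_ofPred_eq]
  push_cast
  linarith

/-- `dyadicWeight s` stands in for `exp (-|u| / s)` in a Laplace transform argument. The small ball
bound at each scale `s (k + 1)` is summed with `∑ 2⁻ᵏ (k + 1) = 4`. -/
theorem lintegral_dyadicWeight_le {Ω : Type*} [MeasurableSpace Ω] {μ : Measure Ω} {X : Ω → ℝ}
    (hX : Measurable X) {c₀ s : ℝ} (hc : 0 ≤ c₀) (hs : 0 < s)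
    (h : ∀ ε : ℝ, 0 < ε → μ {ω | |X ω| ≤ ε} ≤ ENNReal.ofReal (c₀ * ε)) :
    ∫⁻ ω, dyadicWeight s (X ω) ∂μ ≤ ENNReal.ofReal (4 * (c₀ * s)) := by
  have hm : ∀ k : ℕ, Measurable fun ω =>
      {v : ℝ | |v| ≤ s * ((k + 1 : ℕ) : ℝ)}.indicator (1 : ℝ → ENNReal) (X ω) := fun k =>
    (measurable_one.indicator (measurableSet_abs_le _)).comp hX
  unfold dyadicWeight
  rw [lintegral_tsum fun k => ((hm k).const_mul _).aemeasurable, ← tsum_half_pow_mul_succ _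
    (by positivity)]
  refine ENNReal.tsum_le_tsum fun k => ?_
  rw [lintegral_const_mul _ (hm k)]
  gcongr
  have h1 : (fun ω => {v : ℝ | |v| ≤ s * ((k + 1 : ℕ) : ℝ)}.indicator (1 : ℝ → ENNReal) (X ω)) =
      (X ⁻¹' {v : ℝ | |v| ≤ s * ((k + 1 : ℕ) : ℝ)}).indicator 1 := rfl
  rw [h1, lintegral_indicator_one (hX (measurableSet_abs_le _)), mul_assoc]
  exact h _ (by positivity)

/-- Tensorization of small ball estimates for independent random variables. -/
theorem measure_sum_sq_le_of_small_ball {Ω : Type*} [MeasurableSpace Ω] {μ : Measure Ω} {m : ℕ}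
    (hm : 1 ≤ m) {X : Fin m → Ω → ℝ} (hX : ∀ j, Measurable (X j)) (hind : iIndepFun X μ) {c₀ t : ℝ}
    (hc : 0 ≤ c₀) (ht : 0 < t)
    (h : ∀ j, ∀ ε : ℝ, 0 < ε → μ {ω | |X j ω| ≤ ε} ≤ ENNReal.ofReal (c₀ * ε)) :
    μ {ω | ∑ j, X j ω ^ 2 ≤ t ^ 2} ≤ ENNReal.ofReal ((8 * c₀ * t / √m) ^ m) := by
  have hm0 : (0 : ℝ) < m := by exact_mod_cast hm
  have hsm : 0 < √(m : ℝ) := Real.sqrt_pos.2 hm0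
  set s := t / √m with hs_def
  have hs : 0 < s := by positivity
  have hmeas : MeasurableSet {ω | ∑ j, X j ω ^ 2 ≤ t ^ 2} :=
    measurableSet_le (by fun_prop) measurable_const
  -- On the event, Cauchy–Schwarz gives `∑ |X j| ≤ √m t = m s`. The floors of `|X j| / s` then sum
  -- to at most `m`, and the product of weights is at least `2⁻ᵐ`. Independence splits the integral,
  -- with `8 = 2 · 4` per factor.
  have hpt : ∀ ω, {ω | ∑ j, X j ω ^ 2 ≤ t ^ 2}.indicator (1 : Ω → ENNReal) ω ≤
      2 ^ m * ∏ j, dyadicWeight s (X j ω) := by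
    intro ω
    refine Set.indicator_apply_le' (fun hω => ?_) fun _ => zero_le
    rw [Set.mem_ofPred_eq] at hω
    have h1 : ∑ j, ⌊|X j ω| / s⌋₊ ≤ m := by
      have h2 : (∑ j, |X j ω|) ≤ m * s := by
        have h3 := sq_sum_le_card_mul_sum_sq (s := Finset.univ) (f := fun j => |X j ω|)
        simp only [sq_abs, Finset.card_univ, Fintype.card_fin] at h3
        have h4 : (m * s) ^ 2 = m * t ^ 2 := by
          rw [hs_def, mul_pow, div_pow, Real.sq_sqrt hm0.le]
          field_simp
        refine (pow_le_pow_iff_left₀ (by positivity) (by positivity) two_ne_zero).1 ?_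
        rw [h4]
        exact h3.trans (by gcongr)
      have h5 : ((∑ j, ⌊|X j ω| / s⌋₊ : ℕ) : ℝ) ≤ m := by
        push_cast
        calc _ ≤ ∑ j, |X j ω| / s :=
              Finset.sum_le_sum fun j _ => Nat.floor_le (by positivity)
          _ = (∑ j, |X j ω|) / s := by rw [Finset.sum_div]
          _ ≤ m := (div_le_iff₀ hs).2 h2
      exact_mod_cast h5
    calc (1 : ENNReal) = 2 ^ m * 2⁻¹ ^ m := by
          rw [← mul_pow, ENNReal.mul_inv_cancel two_ne_zero ENNReal.ofNat_ne_top, one_pow]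
      _ ≤ 2 ^ m * 2⁻¹ ^ (∑ j, ⌊|X j ω| / s⌋₊) := by
          gcongr 2 ^ m * ?_
          exact pow_le_pow_right_of_le_one' (ENNReal.inv_le_one.2 one_le_two) h1
      _ ≤ _ := by
          rw [← Finset.prod_pow_eq_pow_sum]
          gcongr with j
          exact le_dyadicWeight hs _
  have hgm : ∀ j, Measurable fun ω => dyadicWeight s (X j ω) := fun j =>
    (measurable_dyadicWeight s).comp (hX j)
  calc μ {ω | ∑ j, X j ω ^ 2 ≤ t ^ 2}
      = ∫⁻ ω, {ω | ∑ j, X j ω ^ 2 ≤ t ^ 2}.indicator 1 ω ∂μ := (lintegral_indicator_one hmeas).symm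
    _ ≤ ∫⁻ ω, 2 ^ m * ∏ j, dyadicWeight s (X j ω) ∂μ := lintegral_mono hpt
    _ = 2 ^ m * ∏ j, ∫⁻ ω, dyadicWeight s (X j ω) ∂μ := by
        rw [lintegral_const_mul _ (Finset.measurable_fun_prod _ fun j _ => hgm j)]
        congr 1
        exact lintegral_prod_eq_prod_lintegral_of_indepFun Finset.univ
          (fun j ω => dyadicWeight s (X j ω))
          (hind.comp (fun _ => dyadicWeight s) fun _ => measurable_dyadicWeight s) hgm
    _ ≤ 2 ^ m * ∏ _j : Fin m, ENNReal.ofReal (4 * (c₀ * s)) := by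
        gcongr with j
        exact lintegral_dyadicWeight_le (hX j) hc hs (h j)
    _ = ENNReal.ofReal ((8 * c₀ * t / √m) ^ m) := by
        rw [Finset.prod_const, Finset.card_univ, Fintype.card_fin, ← mul_pow,
          ENNReal.ofReal_pow (by positivity)]
        congr 1
        rw [← ENNReal.ofReal_ofNat 2, ← ENNReal.ofReal_mul (by norm_num)]
        congr 1
        rw [hs_def]
        ring

theorem measure_norm_evalSystem_weylForm_le {Ω : Type*} [MeasurableSpace Ω] {μ : Measure Ω}
    [IsProbabilityMeasure μ] {n m : ℕ} (hm : 1 ≤ m) {d : Fin m → ℕ}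
    {c : ∀ j : Fin m, Ω → EuclideanSpace ℝ (ExponentIndex n (d j))}
    (hcm : ∀ j, Measurable (c j)) (hind : iIndepFun c μ) {c₀ t : ℝ} (hc : 0 ≤ c₀) (ht : 0 < t)
    (hsb : ∀ j, SmallBall μ (c j) c₀) {x : EuclideanSpace ℝ (Fin n)} (hx : ‖x‖ = 1) :
    μ {ω | ‖evalSystem (fun j => weylForm (c j ω)) x‖ ≤ t} ≤
      ENNReal.ofReal ((8 * c₀ * t / √m) ^ m) := by
  have hv : ∀ j, ‖weylVector (d j) x‖ = 1 := fun j => by rw [norm_weylVector, hx, one_pow]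
  have hmeas : ∀ j, Measurable fun v : EuclideanSpace ℝ (ExponentIndex n (d j)) =>
      inner ℝ (weylVector (d j) x) v := fun j => by fun_prop
  have h := measure_sum_sq_le_of_small_ball (μ := μ) hm
    (X := fun j ω => inner ℝ (weylVector (d j) x) (c j ω))
    (fun j => (hmeas j).comp (hcm j)) (hind.comp _ hmeas) hc ht (fun j ε hε => by
      have h1 := hsb j (weylVector (d j) x) (norm_ne_zero_iff.1 (by rw [hv]; exact one_ne_zero)) ε hε
      rw [hv, mul_one] at h1
      rw [← ofReal_measureReal]
      exact ENNReal.ofReal_le_ofReal h1)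
  refine le_trans (le_of_eq ?_) h
  congr 1
  ext ω
  rw [Set.mem_ofPred_eq, Set.mem_ofPred_eq, ← pow_le_pow_iff_left₀ (norm_nonneg _) ht.le two_ne_zero,
    EuclideanSpace.norm_sq_eq]
  simp [evalSystem, eval_weylForm]

theorem measurable_norm_evalSystem_weylForm {Ω : Type*} [MeasurableSpace Ω] {n m : ℕ}
    {d : Fin m → ℕ} {c : ∀ j : Fin m, Ω → EuclideanSpace ℝ (ExponentIndex n (d j))}
    (hcm : ∀ j, Measurable (c j)) :
    Measurable fun q : Ω × EuclideanSpace ℝ (Fin n) =>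
      ‖evalSystem (fun j => weylForm (c j q.1)) (‖q.2‖⁻¹ • q.2)‖ := by
  have h : ∀ j a, Measurable fun q : Ω × EuclideanSpace ℝ (Fin n) => c j q.1 a := fun j a =>
    (EuclideanSpace.proj (𝕜 := ℝ) a).measurable.comp ((hcm j).comp measurable_fst)
  have h1 : ∀ q : Ω × EuclideanSpace ℝ (Fin n),
      ‖evalSystem (fun j => weylForm (c j q.1)) (‖q.2‖⁻¹ • q.2)‖ =
        √(∑ j, |inner ℝ (weylVector (d j) (‖q.2‖⁻¹ • q.2)) (c j q.1)| ^ 2) := fun q => by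
    simp only [EuclideanSpace.norm_eq, evalSystem, ← eval_weylForm, Real.norm_eq_abs]
  simp only [h1, PiLp.inner_apply, weylVector, RCLike.inner_apply, conj_trivial, PiLp.smul_apply,
    smul_eq_mul]
  fun_prop

end

/-! ### Comparison of the sublevel volume with its expectation, and the theorem. -/

noncomputable section

open MeasureTheory ProbabilityTheory Metric

theorem norm_jacobianApply_le {n m D : ℕ} {d : Fin m → ℕ} (hd : ∀ j, 1 ≤ d j) (hD : ∀ j, d j ≤ D)
    (P : Fin m → MvPolynomial (Fin n) ℝ) (x y : EuclideanSpace ℝ (Fin n)) :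
    ‖jacobianApply P x y‖ ≤ √D * ‖degreeScale d (jacobianApply P x y)‖ := by
  refine (pow_le_pow_iff_left₀ (norm_nonneg _) (by positivity) two_ne_zero).1 ?_
  rw [mul_pow, Real.sq_sqrt (Nat.cast_nonneg _), EuclideanSpace.norm_sq_eq,
    EuclideanSpace.norm_sq_eq, Finset.mul_sum]
  refine Finset.sum_le_sum fun j _ => ?_
  have hdj : (0 : ℝ) < d j := by exact_mod_cast hd j
  have hDj : (d j : ℝ) ≤ D := by exact_mod_cast hD j
  have h : ‖(degreeScale d (jacobianApply P x y)) j‖ ^ 2 =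
      (d j : ℝ)⁻¹ * ‖jacobianApply P x y j‖ ^ 2 := by
    simp only [degreeScale, Real.norm_eq_abs, sq_abs]
    rw [mul_pow, inv_pow, Real.sq_sqrt hdj.le]
  rw [h, ← mul_assoc]
  refine le_mul_of_one_le_left (by positivity) ?_
  rw [← div_eq_mul_inv]
  exact (one_le_div hdj).2 hDj

theorem exists_scriptL_lt {n m : ℕ} (hn : 2 ≤ n) (d : Fin m → ℕ)
    (P : Fin m → MvPolynomial (Fin n) ℝ) {r : ℝ} (h : systemL d P < r) :
    ∃ x y : EuclideanSpace ℝ (Fin n), ‖x‖ = 1 ∧ ‖y‖ = 1 ∧ inner ℝ x y = 0 ∧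
      scriptL d P x y < r := by
  have : Nonempty (OrthoPair n) :=
    ⟨⟨(EuclideanSpace.single ⟨0, by omega⟩ 1, EuclideanSpace.single ⟨1, by omega⟩ 1),
      by simp, by simp, by simp [EuclideanSpace.inner_single_left]⟩⟩
  obtain ⟨q, hq⟩ := exists_lt_of_ciInf_lt h
  exact ⟨q.1.1, q.1.2, q.2.1, q.2.2.1, q.2.2.2, hq⟩

theorem continuous_evalSystem {n m : ℕ} (P : Fin m → MvPolynomial (Fin n) ℝ) :
    Continuous (evalSystem P) := by
  refine (PiLp.continuous_toLp 2 _).comp (continuous_pi fun j => ?_)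
  exact (MvPolynomial.continuous_eval (P j)).comp (by fun_prop)

theorem norm_evalSystem_le_systemSupNorm {n m : ℕ} (P : Fin m → MvPolynomial (Fin n) ℝ)
    {x : EuclideanSpace ℝ (Fin n)} (hx : ‖x‖ = 1) : ‖evalSystem P x‖ ≤ systemSupNorm P := by
  have hb : BddAbove (Set.range fun x : sphere (0 : EuclideanSpace ℝ (Fin n)) 1 =>
      ‖evalSystem P x.1‖) :=
    (isCompact_range (by
      have := continuous_evalSystem P
      fun_prop)).bddAbove
  exact le_ciSup hb ⟨x, by simpa using hx⟩

/-- Under the assumptions, the system is small on a set of large volume. -/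
theorem le_volume_sublevel {k m D : ℕ} (hD1 : 1 ≤ D) {d : Fin m → ℕ} (hd : ∀ j, 1 ≤ d j)
    (hD : ∀ j, d j ≤ D) {P : Fin m → MvPolynomial (Fin (k + 2)) ℝ}
    (hP : ∀ j, (P j).totalDegree ≤ D) {α γ : ℝ} (hα : 0 < α) (hγ : 0 < γ)
    (hαγ : α ≤ γ * min (((D : ℝ) ^ 6)⁻¹) ((D : ℝ) ^ 2 / ((k + 2 : ℕ) : ℝ)))
    (hL : systemL d P ≤ α) (hsup : systemSupNorm P < γ) :
    ENNReal.ofReal (4 * √(α / (γ * D ^ 2)) * ((4 * √(α / (γ * D ^ 2))) ^ 2) ^ k) *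
        volume (ball (0 : EuclideanSpace ℝ (Fin (k + 2))) (1 / 2)) ≤
      volume {w | w ∈ ball (0 : EuclideanSpace ℝ (Fin (k + 2))) 8 ∧
        ‖evalSystem P (‖w‖⁻¹ • w)‖ ≤ (10 + 32 * Real.exp 2) * α} := by
  have hD1' : (1 : ℝ) ≤ D := by exact_mod_cast hD1
  have hDpos : (0 : ℝ) < D := by linarith
  set τ := α / (γ * D ^ 2) with hτ
  have hτ0 : 0 < τ := by positivity
  -- Ensures `β ^ 2 = 16 τ ≤ 8`, as `exists_patch` requires.
  have hτk : τ ≤ 1 / 2 := by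
    have h1 : α ≤ γ * ((D : ℝ) ^ 2 / ((k + 2 : ℕ) : ℝ)) := hαγ.trans (by gcongr; exact min_le_right _ _)
    have h2 : (D : ℝ) ^ 2 / ((k + 2 : ℕ) : ℝ) ≤ (D : ℝ) ^ 2 / 2 := by
      gcongr
      push_cast
      linarith [Nat.cast_nonneg (α := ℝ) k]
    rw [hτ, div_le_iff₀ (by positivity)]
    calc α ≤ γ * ((D : ℝ) ^ 2 / 2) := h1.trans (by gcongr)
      _ = _ := by ring
  -- Compensates the factor `√D` lost in passing from `Δ⁻¹DP(x)y` to `DP(x)y`.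
  have hτD : D * τ ≤ 1 := by
    have h1 : α ≤ γ * (((D : ℝ) ^ 6)⁻¹) := hαγ.trans (by gcongr; exact min_le_left _ _)
    have h2 : ((D : ℝ) ^ 6)⁻¹ ≤ 1 := inv_le_one_of_one_le₀ (one_le_pow₀ hD1')
    have h3 : α ≤ γ := h1.trans (mul_le_of_le_one_right hγ.le h2)
    rw [hτ, mul_div_assoc', div_le_one (by positivity)]
    nlinarith [mul_le_mul_of_nonneg_left h3 hDpos.le, mul_pos hγ hDpos]
  -- The slack `2 * α` makes a near-minimizer sufficient; attainment of the infimum is not needed.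
  obtain ⟨x, y, hx, hy, hxy, hlt⟩ := exists_scriptL_lt (by omega) d P
    (hL.trans_lt (by linarith : α < 2 * α))
  have hsq : ‖degreeScale d (jacobianApply P x y)‖ ^ 2 + ‖evalSystem P x‖ ^ 2 < (2 * α) ^ 2 :=
    (Real.sqrt_lt' (by positivity)).1 hlt
  have hJ : ‖degreeScale d (jacobianApply P x y)‖ ≤ 2 * α :=
    (pow_le_pow_iff_left₀ (norm_nonneg _) (by positivity) two_ne_zero).1
      (by linarith [sq_nonneg ‖evalSystem P x‖])
  have hE : ‖evalSystem P x‖ ≤ 2 * α :=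
    (pow_le_pow_iff_left₀ (norm_nonneg _) (by positivity) two_ne_zero).1
      (by linarith [sq_nonneg ‖degreeScale d (jacobianApply P x y)‖])
  have hJ' := norm_jacobianApply_le hd hD P x y
  -- The factor `4` makes `β ^ (2n - 3)` contain `4 ^ (2n - 3)`, which offsets the `16 ^ n` from the
  -- ratio of ball volumes.
  set β := 4 * √τ with hβ
  have hβ0 : 0 < β := by positivity
  have hβ2 : β ^ 2 = 16 * τ := by rw [hβ, mul_pow, Real.sq_sqrt hτ0.le]; norm_num
  obtain ⟨S, hS, hvol, hbd⟩ := exists_patch hD1 P hP (M := γ)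
    (fun x hx => (norm_evalSystem_le_systemSupNorm P hx).trans hsup.le) hx hy hxy hβ0
    (by rw [hβ2]; linarith)
  rw [← hvol]
  refine measure_mono fun w hw => ⟨hS hw, (hbd w hw).trans ?_⟩
  have h1 : ‖jacobianApply P x y‖ * β ≤ 8 * α := by
    calc ‖jacobianApply P x y‖ * β ≤ (√D * (2 * α)) * β := by
          gcongr
          exact hJ'.trans (by gcongr)
      _ = 8 * α * √(D * τ) := by rw [hβ, Real.sqrt_mul hDpos.le]; ring
      _ ≤ 8 * α * 1 := by
          gcongr
          exact Real.sqrt_le_one.2 hτD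
      _ = 8 * α := mul_one _
  have h2 : 2 * (D ^ 2 * (Real.exp 2 * γ) * β ^ 2) = 32 * Real.exp 2 * α := by
    rw [hβ2, hτ]
    field_simp
    norm_num
  rw [h2]
  linarith

/-- By Tonelli the expected sublevel volume is at most the pointwise probability times the volume of
the ball of radius `8`; then Markov. Measuring volumes in units of the ball of radius `1/2` leaves
only the ratio `16 ^ n`. -/
theorem measure_le_volume_sublevel_le {Ω : Type*} [MeasurableSpace Ω] {μ : Measure Ω}
    [IsProbabilityMeasure μ] {k m : ℕ} (hm : 1 ≤ m) {d : Fin m → ℕ}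
    {c : ∀ j : Fin m, Ω → EuclideanSpace ℝ (ExponentIndex (k + 2) (d j))}
    (hcm : ∀ j, Measurable (c j)) (hind : iIndepFun c μ) {c₀ t ρ : ℝ} (hc : 0 ≤ c₀) (ht : 0 < t)
    (hρ : 0 < ρ) (hsb : ∀ j, SmallBall μ (c j) c₀) :
    μ {ω | ENNReal.ofReal ρ * volume (ball (0 : EuclideanSpace ℝ (Fin (k + 2))) (1 / 2)) ≤
      volume {w | w ∈ ball (0 : EuclideanSpace ℝ (Fin (k + 2))) 8 ∧
        ‖evalSystem (fun j => weylForm (c j ω)) (‖w‖⁻¹ • w)‖ ≤ t}} ≤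
      ENNReal.ofReal (16 ^ (k + 2) * (8 * c₀ * t / √m) ^ m / ρ) := by
  set E := EuclideanSpace ℝ (Fin (k + 2))
  set A : Set (Ω × E) := {q | q.2 ∈ ball (0 : E) 8 ∧
    ‖evalSystem (fun j => weylForm (c j q.1)) (‖q.2‖⁻¹ • q.2)‖ ≤ t} with hA
  have hAm : MeasurableSet A :=
    (measurable_snd measurableSet_ball).inter
      (measurableSet_le (measurable_norm_evalSystem_weylForm hcm) measurable_const)
  set V : ENNReal := volume (ball (0 : E) (1 / 2)) with hV
  have hV0 : V ≠ 0 := (measure_ball_pos volume _ (by norm_num)).ne'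
  have hVt : V ≠ ⊤ := measure_ball_lt_top.ne
  set q : ℝ := (8 * c₀ * t / √m) ^ m with hq
  have hq0 : 0 ≤ q := by positivity
  have hball : volume (ball (0 : E) 8) = ENNReal.ofReal (16 ^ (k + 2)) * V := by
    have := Measure.addHaar_ball_mul_of_pos volume (0 : E) (r := 16) (by norm_num) (1 / 2)
    rw [show Module.finrank ℝ E = k + 2 from finrank_euclideanSpace_fin] at this
    rw [← this]
    norm_num
  have hint : ∫⁻ ω, volume (Prod.mk ω ⁻¹' A) ∂μ ≤ ENNReal.ofReal q * volume (ball (0 : E) 8) := by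
    rw [← Measure.prod_apply hAm, Measure.prod_apply_symm hAm, ← setLIntegral_const,
      ← lintegral_indicator measurableSet_ball]
    refine lintegral_mono_ae ?_
    -- At `w = 0` the vector `‖w‖⁻¹ • w` is zero, not a unit vector.
    have hne : ∀ᵐ w : E, w ≠ 0 := by
      rw [ae_iff]
      simp
    filter_upwards [hne] with w hw
    by_cases hw8 : w ∈ ball (0 : E) 8
    · rw [Set.indicator_of_mem hw8]
      refine (measure_mono fun ω hω => ?_).trans (measure_norm_evalSystem_weylForm_le hm hcm hind hc
        ht hsb (x := ‖w‖⁻¹ • w) (norm_smul_inv_norm hw))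
      exact hω.2
    · have : (fun ω => (ω, w)) ⁻¹' A = ∅ := Set.eq_empty_of_forall_notMem fun ω hω => hw8 hω.1
      rw [this, measure_empty]
      exact zero_le
  have hmarkov := mul_meas_ge_le_lintegral (μ := μ) (measurable_measure_prodMk_left (ν := volume) hAm)
    (ENNReal.ofReal ρ * V)
  have hρ0 : ENNReal.ofReal ρ ≠ 0 := (ENNReal.ofReal_pos.2 hρ).ne'
  have h1 := hmarkov.trans hint
  rw [hball, mul_comm (ENNReal.ofReal ρ * V)] at h1
  have h2 := (ENNReal.le_div_iff_mul_le (Or.inl (mul_ne_zero hρ0 hV0))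
    (Or.inl (ENNReal.mul_ne_top ENNReal.ofReal_ne_top hVt))).2 h1
  refine h2.trans (le_of_eq ?_)
  rw [← mul_assoc, ENNReal.mul_div_mul_right _ _ hV0 hVt, ← ENNReal.ofReal_mul hq0,
    ← ENNReal.ofReal_div_of_pos hρ, mul_comm q]

/-- The exponential factors cancel up to `16 ^ n / 4 ^ (2n - 3) = 64`, and `64 ≤ 64 ^ m` is absorbed
into the constant raised to the power `m`. -/
theorem volume_ratio_bound {k m : ℕ} (hm : 1 ≤ m) {α γ c₀ C₁ : ℝ} {D : ℕ} (hD : 1 ≤ D)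
    (hα : 0 < α) (hγ : 0 < γ) (hc : 0 < c₀) (hC₁ : 0 < C₁) :
    16 ^ (k + 2) * (8 * c₀ * (C₁ * α) / √m) ^ m /
      (4 * √(α / (γ * D ^ 2)) * ((4 * √(α / (γ * D ^ 2))) ^ 2) ^ k) ≤
    α ^ ((3 / 2 : ℝ) + (m : ℝ) - ((k + 2 : ℕ) : ℝ)) * √((k + 2 : ℕ) : ℝ) *
      (γ * (D : ℝ) ^ 2) ^ (((k + 2 : ℕ) : ℝ) - 3 / 2) * (512 * C₁ * c₀ / √(m : ℝ)) ^ m := by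
  have hD0 : (0 : ℝ) < D := by exact_mod_cast hD
  have hm0 : (0 : ℝ) < √(m : ℝ) := Real.sqrt_pos.2 (by exact_mod_cast hm)
  set G := γ * (D : ℝ) ^ 2 with hG
  have hG0 : 0 < G := by positivity
  set e : ℝ := ((k + 2 : ℕ) : ℝ) - 3 / 2 with he
  have hden : 4 * √(α / G) * ((4 * √(α / G)) ^ 2) ^ k = 4 ^ (2 * k + 1) * (α ^ e / G ^ e) := by
    rw [← pow_mul, ← pow_succ', mul_pow]
    congr 1
    rw [← Real.div_rpow hα.le hG0.le, Real.sqrt_eq_rpow, ← Real.rpow_mul_natCast (by positivity)]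
    congr 1
    rw [he]
    push_cast
    ring
  have h16 : (16 : ℝ) ^ (k + 2) = 64 * 4 ^ (2 * k + 1) := by
    rw [pow_succ (4 : ℝ), pow_mul, pow_add]
    norm_num
    ring
  have hαp : α ^ ((3 / 2 : ℝ) + (m : ℝ) - ((k + 2 : ℕ) : ℝ)) = α ^ m / α ^ e := by
    rw [← Real.rpow_natCast, ← Real.rpow_sub hα]
    congr 1
    rw [he]
    ring
  have hαe : 0 < α ^ e := Real.rpow_pos_of_pos hα _
  have hGe : 0 < G ^ e := Real.rpow_pos_of_pos hG0 _
  have h64 : (64 : ℝ) ≤ 64 ^ m := le_self_pow₀ (by norm_num) (by omega)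
  have hsn : 1 ≤ √((k + 2 : ℕ) : ℝ) := by
    refine Real.one_le_sqrt.2 ?_
    push_cast
    linarith [Nat.cast_nonneg (α := ℝ) k]
  rw [hden, hαp, h16]
  have hB : 0 ≤ α ^ m / α ^ e * G ^ e * (8 * c₀ * C₁ / √m) ^ m := by positivity
  calc _ = 64 * (α ^ m / α ^ e * G ^ e * (8 * c₀ * C₁ / √m) ^ m) := by
        have : 8 * c₀ * (C₁ * α) / √m = α * (8 * c₀ * C₁ / √m) := by ring
        rw [this, mul_pow]
        field_simp
    _ ≤ (64 ^ m * √((k + 2 : ℕ) : ℝ)) * (α ^ m / α ^ e * G ^ e * (8 * c₀ * C₁ / √m) ^ m) := by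
        gcongr
        exact h64.trans (le_mul_of_one_le_right (by positivity) hsn)
    _ = _ := by
        have : 512 * C₁ * c₀ / √m = 64 * (8 * c₀ * C₁ / √m) := by ring
        rw [this, mul_pow 64]
        ring

end

theorem theorem3p4 :
    ∃ C : ℝ, 0 < C ∧
      ∀ (n m : ℕ), 2 ≤ n → 1 ≤ m →
      ∀ (d : Fin m → ℕ), (∀ j, 1 ≤ d j) →
      ∀ (Ω : Type*) [MeasurableSpace Ω] (μ : MeasureTheory.Measure Ω)
        [MeasureTheory.IsProbabilityMeasure μ]
        (c : ∀ j : Fin m, Ω → EuclideanSpace ℝ (ExponentIndex n (d j))),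
        (∀ j, Measurable (c j)) →
        ProbabilityTheory.iIndepFun c μ →
      ∀ (c₀ : ℝ), 0 < c₀ → (∀ j, SmallBall μ (c j) c₀) →
      ∀ (D : ℕ), D = Finset.univ.sup d →
      ∀ (α γ : ℝ), 0 < α → 0 < γ →
        α ≤ γ * min (((D : ℝ) ^ 6)⁻¹) ((D : ℝ) ^ 2 / (n : ℝ)) →
        μ.real {ω | systemL d (fun j => weylForm (c j ω)) ≤ α} ≤
          μ.real {ω | γ ≤ systemSupNorm (fun j => weylForm (c j ω))} +
            α ^ ((3 / 2 : ℝ) + (m : ℝ) - (n : ℝ)) * √(n : ℝ) *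
              (γ * (D : ℝ) ^ 2) ^ ((n : ℝ) - 3 / 2) * (C * c₀ / √(m : ℝ)) ^ m := by
  -- `512 = 64 · 8`, from the volume ratio and the tensorized small ball bound; the bracket is the
  -- sublevel height in units of `α`.
  refine ⟨512 * (10 + 32 * Real.exp 2), by positivity, ?_⟩
  intro n m hn hm d hd Ω _ μ _ c hcm hind c₀ hc hsb D hD α γ hα hγ hαγ
  obtain ⟨k, rfl⟩ := Nat.exists_eq_add_of_le' hn
  have hdD : ∀ j, d j ≤ D := fun j => hD ▸ Finset.le_sup (Finset.mem_univ j)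
  have hD1 : 1 ≤ D := (hd ⟨0, hm⟩).trans (hdD _)
  have hD0 : (0 : ℝ) < D := by exact_mod_cast hD1
  set ρ : ℝ := 4 * √(α / (γ * D ^ 2)) * ((4 * √(α / (γ * D ^ 2))) ^ 2) ^ k with hρ
  have hρ0 : 0 < ρ := by positivity
  set T : Set Ω := {ω | ENNReal.ofReal ρ *
      MeasureTheory.volume (Metric.ball (0 : EuclideanSpace ℝ (Fin (k + 2))) (1 / 2)) ≤
    MeasureTheory.volume {w | w ∈ Metric.ball (0 : EuclideanSpace ℝ (Fin (k + 2))) 8 ∧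
      ‖evalSystem (fun j => weylForm (c j ω)) (‖w‖⁻¹ • w)‖ ≤ (10 + 32 * Real.exp 2) * α}} with hT
  have hTm : μ.real T ≤ 16 ^ (k + 2) * (8 * c₀ * ((10 + 32 * Real.exp 2) * α) / √m) ^ m / ρ :=
    ENNReal.toReal_le_of_le_ofReal (by positivity)
      (measure_le_volume_sublevel_le hm hcm hind hc.le (by positivity) hρ0 hsb)
  -- Only monotonicity and subadditivity of `μ` are applied to these events, so their measurability
  -- plays no role.
  have hsub : {ω | systemL d (fun j => weylForm (c j ω)) ≤ α} ⊆
      {ω | γ ≤ systemSupNorm (fun j => weylForm (c j ω))} ∪ T := by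
    intro ω hω
    rcases le_or_gt γ (systemSupNorm (fun j => weylForm (c j ω))) with h | h
    · exact Or.inl h
    · exact Or.inr (le_volume_sublevel hD1 hd hdD
        (fun j => (totalDegree_weylForm_le _).trans (hdD j)) hα hγ hαγ hω h)
  calc _ ≤ μ.real {ω | γ ≤ systemSupNorm (fun j => weylForm (c j ω))} + μ.real T :=
        (MeasureTheory.measureReal_mono hsub).trans (MeasureTheory.measureReal_union_le _ _)
    _ ≤ _ := by
        gcongr
        exact hTm.trans (volume_ratio_bound hm hD1 hα hγ hc (by positivity))
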